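/- Let $m\in\mathbb N$ and equip $\mathbb R^m$ with the standard scalar product $\langle\cdot,\cdot\rangle$; let $\mathbb R^m_+=\{x\in\mathbb R^m: x_i\ge 0 \text{ for all } i\}$. For $A\in\mathbb R^{m\times m}$ let $\mathcal O(A)=\{L^{\top}AL : L\in GL_m(\mathbb R)\}$ be its congruence orbit. A matrix $M\in\mathbb R^{m\times m}$ is called an F-matrix if $(M\mathbb R^m_+ + q)\cap\mathbb R^m_+\neq\varnothing$ for every $q\in\mathbb R^m$, and a Q-matrix if for every $q\in\mathbb R^m$ there is an $x\in\mathbb R^m_+$ with $Mx+q\in\mathbb R^m_+$ and $\langle x, Mx+q\rangle=0$. Theorem. Let $A\in\mathbb R^{m\times m}$ be invertible. Suppose that there are $x\in\mathbb R^m$ with $\langle Ax,x\rangle>0$ and $y\in\mathbb R^m\setminus\{0\}$ with $\langle Ay,y\rangle\le 0$. Then $\mathcal O(A)$ contains a matrix that is not an F-matrix, and $\mathcal O(A)$ contains a Q-matrix all of whose entries are positive. -/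

import Mathlib

open scoped Matrix

namespace CongruenceOrbit

/-- The congruence orbit `{Lᵀ A L : L ∈ GL_m(ℝ)}` of a real square matrix `A`. -/
def orbit {m : ℕ} (A : Matrix (Fin m) (Fin m) ℝ) : Set (Matrix (Fin m) (Fin m) ℝ) :=
  {B | ∃ L : GL (Fin m) ℝ,
    B = (L : Matrix (Fin m) (Fin m) ℝ)ᵀ * A * (L : Matrix (Fin m) (Fin m) ℝ)}

/-- The nonnegative orthant of `ℝ^m`. -/
def orthant (m : ℕ) : Set (Fin m → ℝ) := {x | ∀ i, 0 ≤ x i}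

/-- The dual of a cone `K`, with respect to the standard scalar product. -/
def dualCone {m : ℕ} (K : Set (Fin m → ℝ)) : Set (Fin m → ℝ) :=
  {y | ∀ x ∈ K, 0 ≤ x ⬝ᵥ y}

/-- The solution set of the linear complementarity problem on the cone `K` with matrix `M` and
vector `q`: the `x ∈ K` with `M x + q` in the dual cone and orthogonal to `x`. -/
def lcpSol {m : ℕ} (K : Set (Fin m → ℝ)) (M : Matrix (Fin m) (Fin m) ℝ) (q : Fin m → ℝ) :
    Set (Fin m → ℝ) :=
  {x | x ∈ K ∧ M *ᵥ x + q ∈ dualCone K ∧ x ⬝ᵥ (M *ᵥ x + q) = 0}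

/-- The `K`-Q-property: the linear complementarity problem on `K` is solvable for every `q`. -/
def HasQProperty {m : ℕ} (K : Set (Fin m → ℝ)) (A : Matrix (Fin m) (Fin m) ℝ) : Prop :=
  ∀ q : Fin m → ℝ, (lcpSol K A q).Nonempty

/-- The general feasibility property with respect to `K`:
`(A K + q) ∩ K* ≠ ∅` for every `q`. -/
def HasFProperty {m : ℕ} (K : Set (Fin m → ℝ)) (A : Matrix (Fin m) (Fin m) ℝ) : Prop :=
  ∀ q : Fin m → ℝ, (((fun x => A *ᵥ x + q) '' K) ∩ dualCone K).Nonempty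

/-- Q-matrices: the Q-property with respect to the nonnegative orthant. -/
def IsQMatrix {m : ℕ} (A : Matrix (Fin m) (Fin m) ℝ) : Prop := HasQProperty (orthant m) A

/-- F-matrices: the feasibility property with respect to the nonnegative orthant. -/
def IsFMatrix {m : ℕ} (A : Matrix (Fin m) (Fin m) ℝ) : Prop := HasFProperty (orthant m) A

/-- Entrywise positive matrices. -/
def IsPositive {m : ℕ} (A : Matrix (Fin m) (Fin m) ℝ) : Prop := ∀ i j, 0 < A i j

end CongruenceOrbit

/-! The entries of `Lᵀ * A * L` are `⟨A ℓⱼ, ℓᵢ⟩` for the columns `ℓᵢ` of `L`, so the orbit consists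
of the Gram matrices of the form of `A` in all bases. A basis containing `y`, with the signs of the
other vectors chosen suitably, gives a nonpositive row, which rules out feasibility. A basis
clustered around `x` has all entries close to `⟨Ax, x⟩ > 0`.

It remains to see that a positive `M` is a Q-matrix. On the indices with `q i < 0`, take a point `p`
of the simplex whose support lies where `(M p) i / (-q i)` is minimal; rescaled so that this minimum
becomes `1`, it solves the complementarity problem. Such a `p` exists for any continuous map in
place of these ratios: colour fine grids by a minimizing index, find near-colourful clusters by
Scarf's lemma, and pass to a limit. Scarf's lemma is a parity count of doors and rooms. -/

namespace CongruenceOrbit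

/-! ### Scarf's lemma -/

section Scarf

variable {W ι α : Type*} [LinearOrder α]

/-- A finite set is dominating for a family of utilities `f` if no `w` is strictly better, for
every utility, than the worst element of the set. -/
def Dominating (f : ι → W → α) (S : Finset W) : Prop := ∀ w, ∃ i, ∀ x ∈ S, f i w ≤ f i x

theorem Dominating.mono {f : ι → W → α} {S T : Finset W} (hS : Dominating f S) (h : T ⊆ S) :
    Dominating f T := fun w =>
  let ⟨i, hi⟩ := hS w
  ⟨i, fun x hx => hi x (h hx)⟩

theorem Dominating.exists_minimizer_eq {f : ι → W → α}
    (hf : ∀ i, Function.Injective (f i)) {τ : Finset W} {μ : ι → W} (hμ : ∀ i, μ i ∈ τ)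
    (hmin : ∀ i, ∀ x ∈ τ, f i (μ i) ≤ f i x) (hd : Dominating f τ) {x : W} (hx : x ∈ τ) :
    ∃ i, μ i = x := by
  obtain ⟨i, hi⟩ := hd x
  exact ⟨i, hf i (le_antisymm (hmin i x hx) (hi _ (hμ i)))⟩

/-- If `τ` stays dominating when `y` is added, then the utilities whose minimum does not move to
`y` still attain their minima at every point of `τ`. -/
theorem Dominating.exists_minimizer_eq_of_insert [DecidableEq W] {f : ι → W → α}
    (hf : ∀ i, Function.Injective (f i)) {τ : Finset W} {μ : ι → W} (hμ : ∀ i, μ i ∈ τ)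
    (hmin : ∀ i, ∀ x ∈ τ, f i (μ i) ≤ f i x) {y : W} (hd : Dominating f (insert y τ)) {x : W}
    (hx : x ∈ τ) : ∃ i, μ i = x ∧ f i (μ i) ≤ f i y := by
  obtain ⟨i, hi⟩ := hd x
  have h : μ i = x :=
    hf i (le_antisymm (hmin i x hx) (hi _ (Finset.mem_insert_of_mem (hμ i))))
  exact ⟨i, h, h ▸ hi y (Finset.mem_insert_self _ _)⟩

/-- Every point of `τ` must remain the minimizer of a utility that does not prefer it to `y`. If two
utilities moved their minimum to `y`, too few would be left to cover the points of `τ`. -/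
theorem Dominating.eq_of_lt_minimizer [DecidableEq W] [Fintype ι] {f : ι → W → α}
    (hf : ∀ i, Function.Injective (f i)) {τ : Finset W} {μ : ι → W} (hμ : ∀ i, μ i ∈ τ)
    (hmin : ∀ i, ∀ x ∈ τ, f i (μ i) ≤ f i x) (hcard : τ.card + 1 = Fintype.card ι)
    {y : W} (hd : Dominating f (insert y τ)) {i j : ι} (hi : f i y < f i (μ i))
    (hj : f j y < f j (μ j)) : i = j := by
  classical
  by_contra hij
  have hsub : τ ⊆ ((Finset.univ.erase i).erase j).image μ := by
    intro x hx
    obtain ⟨l, hl, hly⟩ := hd.exists_minimizer_eq_of_insert hf hμ hmin hx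
    refine Finset.mem_image.2 ⟨l, ?_, hl⟩
    simp only [Finset.mem_erase, Finset.mem_univ, and_true]
    exact ⟨fun h => (h ▸ hly).not_gt hj, fun h => (h ▸ hly).not_gt hi⟩
  have h1 := (Finset.card_le_card hsub).trans Finset.card_image_le
  rw [Finset.card_erase_of_mem (by simp [Ne.symm hij]), Finset.card_erase_of_mem (by simp),
    Finset.card_univ] at h1
  have : 1 < Fintype.card ι := Fintype.one_lt_card_iff.2 ⟨i, j, hij⟩
  omega

/-- Among the points that beat `τ` in all utilities but `a`, the one that is best for `a` can be
added to `τ`, and it is the only one that takes over the minimum of `f a`. -/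
theorem Dominating.exists_insert [DecidableEq W] [Fintype W] [Fintype ι] {f : ι → W → α}
    (hf : ∀ i, Function.Injective (f i)) {τ : Finset W} {μ : ι → W} (hμ : ∀ i, μ i ∈ τ)
    (hmin : ∀ i, ∀ x ∈ τ, f i (μ i) ≤ f i x) (hcard : τ.card + 1 = Fintype.card ι)
    (hd : Dominating f τ) {a b : ι} (hab : a ≠ b) (hμab : μ a = μ b)
    (hw : ∃ w, ∀ i, i ≠ a → f i (μ i) < f i w) :
    ∃ y, y ∉ τ ∧ Dominating f (insert y τ) ∧ f a y < f a (μ a) ∧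
      ∀ z, z ∉ τ → Dominating f (insert z τ) → f a z < f a (μ a) → z = y := by
  classical
  obtain ⟨w, hw⟩ := hw
  obtain ⟨y, hy, hymax⟩ := Finset.exists_max_image
    (Finset.univ.filter fun w => ∀ i, i ≠ a → f i (μ i) < f i w) (f a) ⟨w, by simpa using hw⟩
  simp only [Finset.mem_filter, Finset.mem_univ, true_and] at hy hymax
  have hyτ : y ∉ τ := by
    intro hyτ
    obtain ⟨i, hi⟩ := hd.exists_minimizer_eq hf hμ hmin hyτ
    by_cases hia : i = a
    · have := hy b hab.symm
      rw [← hμab, ← hia, hi] at this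
      exact this.ne rfl
    · have := hy i hia
      rw [hi] at this
      exact this.ne rfl
  have hya : f a y < f a (μ a) := by
    obtain ⟨i, hi⟩ := hd y
    have hi' := hi _ (hμ i)
    have hia : i = a := by
      by_contra h
      exact hi'.not_gt (hy i h)
    subst hia
    exact lt_of_le_of_ne hi' fun h => hyτ (hf i h ▸ hμ i)
  refine ⟨y, hyτ, ?_, hya, ?_⟩
  · intro v
    by_cases hv : ∀ i, i ≠ a → f i (μ i) < f i v
    · refine ⟨a, fun x hx => ?_⟩
      rcases Finset.mem_insert.1 hx with rfl | hx
      · exact hymax v hv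
      · exact ((hymax v hv).trans hya.le).trans (hmin a x hx)
    · push Not at hv
      obtain ⟨i, hia, hi⟩ := hv
      refine ⟨i, fun x hx => hi.trans ?_⟩
      rcases Finset.mem_insert.1 hx with rfl | hx
      · exact (hy i hia).le
      · exact hmin i x hx
  · intro z hzτ hzd hza
    have hz : ∀ i, i ≠ a → f i (μ i) < f i z := by
      intro i hia
      by_contra h
      have hne : f i z ≠ f i (μ i) := fun h => hzτ (hf i h ▸ hμ i)
      exact hia (hzd.eq_of_lt_minimizer hf hμ hmin hcard (lt_of_le_of_ne (not_lt.1 h) hne) hza)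
    refine hf a (le_antisymm (hymax z hz) ?_)
    obtain ⟨i, hi⟩ := hzd y
    by_cases hia : i = a
    · exact hia ▸ hi z (Finset.mem_insert_self _ _)
    · exact absurd (hi _ (Finset.mem_insert_of_mem (hμ i))) (hy i hia).not_ge

/-- A dominating set with one element too few extends to a dominating set in exactly two ways. -/
theorem Dominating.exists_two_extensions [Fintype W] [Fintype ι] {f : ι → W → α}
    (hf : ∀ i, Function.Injective (f i)) {τ : Finset W} (hne : τ.Nonempty)
    (hcard : τ.card + 1 = Fintype.card ι) (hd : Dominating f τ)
    (hw : ∀ a, ∃ w, ∀ i, i ≠ a → ∃ x ∈ τ, f i x < f i w) :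
    ∃ S₁ S₂ : Finset W, S₁ ≠ S₂ ∧ ∀ S : Finset W,
      (S.card = Fintype.card ι ∧ Dominating f S ∧ τ ⊆ S) ↔ S = S₁ ∨ S = S₂ := by
  classical
  have hex : ∀ i, ∃ x ∈ τ, ∀ z ∈ τ, f i x ≤ f i z := fun i => Finset.exists_min_image τ (f i) hne
  choose μ hμ hmin using hex
  have hw' : ∀ a, ∃ w, ∀ i, i ≠ a → f i (μ i) < f i w := fun a =>
    let ⟨w, h⟩ := hw a
    ⟨w, fun i hi => let ⟨x, hx, hxw⟩ := h i hi; (hmin i x hx).trans_lt hxw⟩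
  -- There is one utility more than points, so two share a minimizer. Each of these two yields one
  -- extension.
  obtain ⟨a, -, b, -, hab, hμab⟩ := Finset.exists_ne_map_eq_of_card_lt_of_maps_to
    (s := (Finset.univ : Finset ι)) (t := τ) (by rw [Finset.card_univ]; omega)
    (f := μ) (fun i _ => hμ i)
  obtain ⟨y, hyτ, hyd, hya, hyu⟩ := hd.exists_insert hf hμ hmin hcard hab hμab (hw' a)
  obtain ⟨y', hyτ', hyd', hyb', hyu'⟩ :=
    hd.exists_insert hf hμ hmin hcard hab.symm hμab.symm (hw' b)
  refine ⟨insert y τ, insert y' τ, ?_, fun S => ⟨?_, ?_⟩⟩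
  · intro h
    have hyy : y = y' := by
      have := h ▸ Finset.mem_insert_self y τ
      exact (Finset.mem_insert.1 this).resolve_right hyτ
    subst hyy
    exact hab (hyd.eq_of_lt_minimizer hf hμ hmin hcard hya hyb')
  · rintro ⟨hSc, hSd, hτS⟩
    obtain ⟨z, hz⟩ := Finset.card_eq_one.1
      (show (S \ τ).card = 1 by rw [Finset.card_sdiff_of_subset hτS]; omega)
    have hzS : z ∈ S \ τ := hz ▸ Finset.mem_singleton_self z
    have hzτ : z ∉ τ := (Finset.mem_sdiff.1 hzS).2
    have hS : S = insert z τ := by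
      rw [← Finset.sdiff_union_of_subset hτS, hz, Finset.singleton_union]
    subst hS
    obtain ⟨i, hi⟩ := hSd z
    have hiz : f i z < f i (μ i) :=
      lt_of_le_of_ne (hi _ (Finset.mem_insert_of_mem (hμ i))) fun h => hzτ (hf i h ▸ hμ i)
    -- The utilities other than `i` are as many as the points of `τ` and cover them, hence have
    -- distinct minimizers; so `i` is one of the pair `a`, `b`.
    have hsurj : ∀ x ∈ τ, ∃ j ∈ Finset.univ.erase i, μ j = x := by
      intro x hx
      obtain ⟨l, hl, hly⟩ := hSd.exists_minimizer_eq_of_insert hf hμ hmin hx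
      exact ⟨l, by simpa using fun h => (h ▸ hly).not_gt hiz, hl⟩
    have hinj := Finset.inj_on_of_surj_on_of_card_le (fun j (_ : j ∈ Finset.univ.erase i) => μ j)
      (fun j _ => hμ j) (fun x hx => let ⟨j, hj, h⟩ := hsurj x hx; ⟨j, hj, h⟩)
      (by rw [Finset.card_erase_of_mem (Finset.mem_univ i), Finset.card_univ]; omega)
    have hiab : i = a ∨ i = b := by
      by_contra h
      push Not at h
      exact hab (hinj (by simpa using h.1.symm) (by simpa using h.2.symm) hμab)
    rcases hiab with rfl | rfl
    · exact Or.inl (by rw [hyu z hzτ hSd hiz])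
    · exact Or.inr (by rw [hyu' z hzτ hSd hiz])
  · rintro (rfl | rfl)
    · exact ⟨by rw [Finset.card_insert_of_notMem hyτ]; exact hcard, hyd,
        Finset.subset_insert _ _⟩
    · exact ⟨by rw [Finset.card_insert_of_notMem hyτ']; exact hcard, hyd',
        Finset.subset_insert _ _⟩

/-- Scarf's lemma: if every utility `f i` has a slack element `s i` that is its worst element and
better than all non-slack elements for the other utilities, then for each colouring that gives
`s i` the colour `i` there is a dominating set containing all colours. -/
theorem exists_dominating_colorful [Fintype W] [Fintype ι] {f : ι → W → α}
    (hf : ∀ i, Function.Injective (f i)) {s : ι → W}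
    (hbot : ∀ i w, w ≠ s i → f i (s i) < f i w)
    (htop : ∀ i j, i ≠ j → ∀ v, v ∉ Set.range s → f i v < f i (s j))
    (hV : ∃ v, v ∉ Set.range s) (c : W → ι) (hc : ∀ i, c (s i) = i) :
    ∃ S : Finset W, Dominating f S ∧ ∀ i, ∃ x ∈ S, c x = i := by
  classical
  obtain ⟨v₀, hv₀⟩ := hV
  let k : ι := c v₀
  have hs : Function.Injective s := fun i j h => by rw [← hc i, h, hc j]
  by_contra hno
  push Not at hno
  let R : Finset (Finset W) :=
    Finset.univ.filter fun S => S.card = Fintype.card ι ∧ Dominating f S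
  -- Rooms `R` are full-size dominating sets; doors `D` are one element smaller and show every
  -- colour but `k`. Incidences are counted in two ways modulo 2.
  let D : Finset (Finset W) := Finset.univ.filter fun τ =>
    τ.card + 1 = Fintype.card ι ∧ τ.image c = Finset.univ.erase k ∧ Dominating f τ
  have hcount := Finset.sum_card_bipartiteAbove_eq_sum_card_bipartiteBelow
    (s := D) (t := R) (fun τ S => τ ⊆ S)
  have hrooms : Even (∑ S ∈ R, (D.bipartiteBelow (fun τ S => τ ⊆ S) S).card) := by
    refine Finset.even_sum _ fun S hS => ?_
    obtain ⟨hSc, hSd⟩ := (Finset.mem_filter.1 hS).2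
    rcases Finset.eq_empty_or_nonempty (D.bipartiteBelow (fun τ S => τ ⊆ S) S) with h0 | ⟨τ, hτ⟩
    · rw [h0]; exact ⟨0, rfl⟩
    have herase : ∀ τ, τ.card + 1 = Fintype.card ι → τ ⊆ S → ∃ x ∈ S, τ = S.erase x := by
      intro τ hτc hτS
      obtain ⟨z, hz⟩ := Finset.card_eq_one.1
        (show (S \ τ).card = 1 by rw [Finset.card_sdiff_of_subset hτS]; omega)
      have hzS : z ∈ S \ τ := hz ▸ Finset.mem_singleton_self z
      refine ⟨z, (Finset.mem_sdiff.1 hzS).1, ?_⟩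
      rw [Finset.erase_eq, ← hz, Finset.sdiff_sdiff_eq_self hτS]
    obtain ⟨hτD, hτS⟩ := (Finset.mem_bipartiteBelow _).1 hτ
    obtain ⟨hτc, hτi, -⟩ := (Finset.mem_filter.1 hτD).2
    obtain ⟨x, hxS, rfl⟩ := herase τ hτc hτS
    obtain ⟨l, hl⟩ := hno S hSd
    have himg : ∀ j, j ≠ k → ∃ x' ∈ S.erase x, c x' = j := by
      intro j hj
      have : j ∈ (S.erase x).image c := hτi ▸ by simpa using hj
      exact Finset.mem_image.1 this
    have hlk : l = k := by
      by_contra h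
      obtain ⟨x', hx', h'⟩ := himg l h
      exact hl x' (Finset.mem_of_mem_erase hx') h'
    -- The room lacks only the colour `k`, so one colour occurs twice, at `x` and `x'`. Erasing
    -- either gives a door, and no other erasure does.
    obtain ⟨x', hx', hcx⟩ := himg (c x) fun h => hl x hxS (h.trans hlk.symm)
    obtain ⟨hxx, hxS'⟩ := Finset.mem_erase.1 hx'
    have himg' : (S.erase x').image c = Finset.univ.erase k := by
      rw [← hτi]
      ext j
      simp only [Finset.mem_image, Finset.mem_erase]
      constructor
      · rintro ⟨z, ⟨-, hz⟩, rfl⟩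
        by_cases h : z = x
        · exact ⟨x', ⟨hxx, hxS'⟩, h ▸ hcx⟩
        · exact ⟨z, ⟨h, hz⟩, rfl⟩
      · rintro ⟨z, ⟨-, hz⟩, rfl⟩
        by_cases h : z = x'
        · exact ⟨x, ⟨hxx.symm, hxS⟩, h ▸ hcx.symm⟩
        · exact ⟨z, ⟨h, hz⟩, rfl⟩
    have hpair : D.bipartiteBelow (fun τ S => τ ⊆ S) S = {S.erase x, S.erase x'} := by
      ext τ
      simp only [Finset.mem_bipartiteBelow, Finset.mem_insert, Finset.mem_singleton]
      constructor
      · rintro ⟨hτD', hτS'⟩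
        obtain ⟨hτc', hτi', -⟩ := (Finset.mem_filter.1 hτD').2
        obtain ⟨z, hzS, rfl⟩ := herase τ hτc' hτS'
        by_contra h
        have hzx : x ≠ z := fun e => h (Or.inl (by rw [e]))
        have hzx' : x' ≠ z := fun e => h (Or.inr (by rw [e]))
        have hinj : Set.InjOn c (S.erase z) := by
          refine Finset.card_image_iff.1 ?_
          rw [hτi', Finset.card_erase_of_mem (Finset.mem_univ k), Finset.card_univ]
          omega
        exact hxx (hinj (by simp [hzx', hxS']) (by simp [hzx, hxS]) hcx)
      · rintro (rfl | rfl)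
        · exact ⟨hτD, hτS⟩
        · refine ⟨Finset.mem_filter.2 ⟨Finset.mem_univ _, ?_, himg',
            hSd.mono (Finset.erase_subset _ _)⟩, Finset.erase_subset _ _⟩
          rw [Finset.card_erase_of_mem hxS']
          rw [Finset.card_erase_of_mem hxS] at hτc
          exact hτc
    rw [hpair, Finset.card_pair]
    · exact ⟨1, rfl⟩
    · intro h
      exact Finset.notMem_erase x S (h ▸ Finset.mem_erase.2 ⟨hxx.symm, hxS⟩)
  let τ₀ : Finset W := (Finset.univ.erase k).image s
  have hcard₀ : τ₀.card + 1 = Fintype.card ι := by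
    have : 0 < Fintype.card ι := Fintype.card_pos_iff.2 ⟨k⟩
    rw [Finset.card_image_of_injective _ hs, Finset.card_erase_of_mem (Finset.mem_univ k),
      Finset.card_univ]
    omega
  have hle : ∀ i w, f i (s i) ≤ f i w := fun i w => by
    by_cases h : w = s i
    · rw [h]
    · exact (hbot i w h).le
  have hτ₀ : τ₀ ∈ D := by
    refine Finset.mem_filter.2 ⟨Finset.mem_univ _, hcard₀, ?_, fun w => ?_⟩
    · rw [Finset.image_image, show c ∘ s = id from funext hc, Finset.image_id]
    · by_cases hw : w ∈ Set.range s
      · obtain ⟨i, rfl⟩ := hw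
        exact ⟨i, fun x _ => hle i x⟩
      · refine ⟨k, fun x hx => ?_⟩
        obtain ⟨j, hj, rfl⟩ := Finset.mem_image.1 hx
        exact (htop k j (Finset.ne_of_mem_erase hj).symm w hw).le
  -- Any other door contains a non-slack `v`. Since `s a` beats `v` for all utilities except `a`,
  -- the two-extension lemma applies.
  have hdoors : ∀ τ ∈ D.erase τ₀, Even (R.bipartiteAbove (fun τ S => τ ⊆ S) τ).card := by
    intro τ hτ
    obtain ⟨hne, hτD⟩ := Finset.mem_erase.1 hτ
    obtain ⟨hτc, hτi, hτd⟩ := (Finset.mem_filter.1 hτD).2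
    obtain ⟨v, hvτ, hv⟩ : ∃ v ∈ τ, v ∉ Set.range s := by
      by_contra h
      push Not at h
      refine hne ?_
      ext x
      simp only [τ₀, ← hτi, Finset.mem_image]
      constructor
      · intro hx
        obtain ⟨i, rfl⟩ := h x hx
        exact ⟨i, ⟨s i, hx, hc i⟩, rfl⟩
      · rintro ⟨i, ⟨y, hy, rfl⟩, rfl⟩
        obtain ⟨i, rfl⟩ := h y hy
        rwa [hc]
    obtain ⟨S₁, S₂, hS, h⟩ := hτd.exists_two_extensions hf ⟨v, hvτ⟩ hτc
      fun a => ⟨s a, fun i hi => ⟨v, hvτ, htop i a hi v hv⟩⟩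
    have : R.bipartiteAbove (fun τ S => τ ⊆ S) τ = {S₁, S₂} := by
      ext S
      rw [Finset.mem_bipartiteAbove, Finset.mem_insert, Finset.mem_singleton, ← h S,
        Finset.mem_filter]
      simp [and_assoc]
    rw [this, Finset.card_pair hS]
    exact ⟨1, rfl⟩
  -- The only point that can be added to the slack door is the non-slack point best for `k`:
  -- domination at a non-slack point can only be witnessed by `k`.
  have hdoor₀ : (R.bipartiteAbove (fun τ S => τ ⊆ S) τ₀).card = 1 := by
    obtain ⟨v, hv, hvmax⟩ := Finset.exists_max_image
      (Finset.univ.filter fun w => w ∉ Set.range s) (f k) ⟨v₀, by simpa using hv₀⟩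
    simp only [Finset.mem_filter, Finset.mem_univ, true_and] at hv hvmax
    have hvτ : v ∉ τ₀ := fun h =>
      let ⟨i, _, hi⟩ := Finset.mem_image.1 h
      hv ⟨i, hi⟩
    refine Finset.card_eq_one.2 ⟨insert v τ₀, ?_⟩
    ext S
    rw [Finset.mem_bipartiteAbove, Finset.mem_singleton, Finset.mem_filter]
    constructor
    · rintro ⟨⟨-, hSc, hSd⟩, hτS⟩
      obtain ⟨z, hz⟩ := Finset.card_eq_one.1
        (show (S \ τ₀).card = 1 by rw [Finset.card_sdiff_of_subset hτS]; omega)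
      have hS : S = insert z τ₀ := by
        rw [← Finset.sdiff_union_of_subset hτS, hz, Finset.singleton_union]
      have hmem : ∀ i, i ≠ k → s i ∈ S := fun i hi =>
        hτS (Finset.mem_image.2 ⟨i, by simpa using hi, rfl⟩)
      have key : ∀ w, w ∉ Set.range s → f k w ≤ f k z := by
        intro w hw
        obtain ⟨i, hi⟩ := hSd w
        have hik : i = k := by
          by_contra h
          exact (hi _ (hmem i h)).not_gt (hbot i w fun h => hw ⟨i, h.symm⟩)
        exact hik ▸ hi z (hS ▸ Finset.mem_insert_self z τ₀)
      have hzr : z ∉ Set.range s := by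
        rintro ⟨i, rfl⟩
        have hi : i = k := by
          by_contra h
          have : s i ∈ S \ τ₀ := hz ▸ Finset.mem_singleton_self _
          exact (Finset.mem_sdiff.1 this).2 (Finset.mem_image.2 ⟨i, by simpa using h, rfl⟩)
        exact (key v hv).not_gt (hi ▸ hbot i v fun h => hv ⟨i, h.symm⟩)
      rw [hS, hf k (le_antisymm (hvmax z hzr) (key v hv))]
    · rintro rfl
      refine ⟨⟨Finset.mem_univ _, ?_, fun w => ?_⟩, Finset.subset_insert _ _⟩
      · rw [Finset.card_insert_of_notMem hvτ]; exact hcard₀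
      · by_cases hw : w ∈ Set.range s
        · obtain ⟨i, rfl⟩ := hw
          exact ⟨i, fun x _ => hle i x⟩
        · refine ⟨k, fun x hx => ?_⟩
          rcases Finset.mem_insert.1 hx with rfl | hx
          · exact hvmax w hw
          · obtain ⟨j, hj, rfl⟩ := Finset.mem_image.1 hx
            exact (htop k j (Finset.ne_of_mem_erase hj).symm w hw).le
  rw [← hcount, ← Finset.add_sum_erase _ _ hτ₀, hdoor₀] at hrooms
  have := Finset.even_sum _ hdoors
  rw [Nat.even_add] at hrooms
  exact absurd (hrooms.2 this) (by decide)

end Scarf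

end CongruenceOrbit

namespace CongruenceOrbit

/-! ### From grid colourings to minimal supports on the simplex -/

section Simplex

/-- For every colouring of the grid points of a simplex there is a grid point such that each of
its coordinates is small or the corresponding colour occurs nearby. -/
theorem exists_grid_point {ι : Type*} [Fintype ι] [Nonempty ι] (n : ℕ) (c : (ι → ℕ) → ι) :
    ∃ v : ι → ℕ, ∑ i, v i = n ∧ ∀ i, v i < Fintype.card ι ∨
      ∃ v' : ι → ℕ, ∑ i, v' i = n ∧ c v' = i ∧
        ∀ j, v j < v' j + Fintype.card ι ∧ v' j < v j + Fintype.card ι := by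
  classical
  let V := {v : ι → ℕ // v ∈ Finset.piAntidiag Finset.univ n}
  have hVsum : ∀ v : V, ∑ i, v.1 i = n := fun v => (Finset.mem_piAntidiag.1 v.2).1
  have : Fintype V := Finset.fintypeCoeSort _
  let e := Fintype.equivFin (V ⊕ ι)
  -- Grid points take values from `1` to `n + 1`, strictly between the own slack `0` and the foreign
  -- slack `n + 2`. In `f`, the enumeration `e` breaks ties.
  let h : ι → V ⊕ ι → ℕ := fun i => Sum.elim (fun v => v.1 i + 1) fun j => if j = i then 0 else n + 2
  let f : ι → V ⊕ ι → ℕ ×ₗ ℕ := fun i w => toLex (h i w, (e w : ℕ))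
  have hlt : ∀ i w w', h i w < h i w' → f i w < f i w' := fun i w w' hh =>
    Prod.Lex.toLex_lt_toLex.2 (Or.inl hh)
  have hle : ∀ i w w', f i w ≤ f i w' → h i w ≤ h i w' := fun i w w' hh => by
    by_contra hcon
    exact hh.not_gt (hlt i _ _ (not_le.1 hcon))
  have hinj : ∀ i, Function.Injective (f i) := fun i w w' hh =>
    e.injective (Fin.ext (congrArg (fun p => (ofLex p).2) hh))
  have hbound : ∀ (v : V) i, v.1 i ≤ n := fun v i =>
    (Finset.single_le_sum (fun _ _ => Nat.zero_le _) (Finset.mem_univ i)).trans_eq (hVsum v)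
  let v₀ : V := ⟨Pi.single (Classical.arbitrary ι) n, by simp⟩
  have hnr : ∀ v : V, (Sum.inl v : V ⊕ ι) ∉ Set.range (Sum.inr : ι → V ⊕ ι) := by simp
  obtain ⟨S, hSd, hSc⟩ := exists_dominating_colorful hinj (s := Sum.inr)
    (by
      rintro i (v | j) hw
      · exact hlt _ _ _ (by simp [h])
      · have hji : j ≠ i := fun hj => hw (by rw [hj])
        exact hlt _ _ _ (by simp [h, hji]))
    (by
      rintro i j hij (v | l) hv
      · refine hlt _ _ _ ?_
        have := hbound v i
        simp only [h, Sum.elim_inl, Sum.elim_inr, hij.symm, if_false]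
        omega
      · exact absurd ⟨l, rfl⟩ hv)
    ⟨Sum.inl v₀, hnr v₀⟩ (Sum.elim (fun v => c v.1) id) (fun i => rfl)
  have hSne : S.Nonempty := let ⟨x, hx, _⟩ := hSc (Classical.arbitrary ι); ⟨x, hx⟩
  choose μ hμ hmin using fun i => Finset.exists_min_image S (f i) hSne
  -- Otherwise the minima, with the missing amount added to one coordinate, would form a grid point
  -- beating all of them, as its utilities carry an extra `1`.
  have hsum : n < ∑ i, h i (μ i) := by
    by_contra hcon
    push Not at hcon
    let i₀ := Classical.arbitrary ι
    let v : ι → ℕ := fun i => h i (μ i) + (Pi.single i₀ (n - ∑ i, h i (μ i)) : ι → ℕ) i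
    have hv : ∑ i, v i = n := by
      simp only [v, Finset.sum_add_distrib, Finset.sum_pi_single', Finset.mem_univ, if_true]
      omega
    obtain ⟨i, hi⟩ := hSd (Sum.inl ⟨v, by simpa using hv⟩)
    have := hle _ _ _ (hi _ (hμ i))
    simp only [h, Sum.elim_inl, v] at this
    omega
  -- The excesses over the minima are nonnegative with sum less than `Fintype.card ι`, so all grid
  -- points of `S` lie close together.
  have hnear : ∀ v : V, Sum.inl v ∈ S → ∀ i, h i (μ i) ≤ v.1 i + 1 ∧
      v.1 i + 1 < h i (μ i) + Fintype.card ι := by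
    intro v hv i
    have h1 : ∀ j, h j (μ j) ≤ v.1 j + 1 := fun j => hle _ _ _ (hmin j _ hv)
    refine ⟨h1 i, ?_⟩
    have h2 : ∑ j, (v.1 j + 1 - h j (μ j)) + ∑ j, h j (μ j) = n + Fintype.card ι := by
      rw [← Finset.sum_add_distrib, Finset.sum_congr rfl fun j _ => Nat.sub_add_cancel (h1 j),
        Finset.sum_add_distrib, hVsum]
      simp
    have h3 := Finset.single_le_sum (f := fun j => v.1 j + 1 - h j (μ j))
      (fun _ _ => Nat.zero_le _) (Finset.mem_univ i)
    omega
  have hslack : ∀ i, Sum.inr i ∈ S → h i (μ i) = 0 := fun i hi => by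
    have := hle _ _ _ (hmin i _ hi)
    simpa [h] using this
  obtain ⟨v, hv⟩ : ∃ v : V, Sum.inl v ∈ S := by
    by_contra hcon
    push Not at hcon
    obtain ⟨i, hi⟩ := hSd (Sum.inl v₀)
    obtain ⟨x | x, hx, hxi⟩ := hSc i
    · exact hcon x hx
    · have hxi : x = i := hxi
      have := hle _ _ _ (hi _ hx)
      simp [h, hxi] at this
  refine ⟨v.1, hVsum v, fun i => ?_⟩
  obtain ⟨x | x, hx, hxi⟩ := hSc i
  · refine Or.inr ⟨x.1, hVsum x, hxi, fun j => ?_⟩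
    have h1 := hnear v hv j
    have h2 := hnear x hx j
    omega
  · have hxi : x = i := hxi
    have h1 := hnear v hv i
    rw [hslack i (hxi ▸ hx)] at h1
    left
    omega

/-- A continuous map `F` admits a point of the standard simplex whose support consists of indices
where `F` has its smallest coordinate. -/
theorem exists_mem_stdSimplex_support_minimal {ι : Type*} [Fintype ι] [Nonempty ι]
    {F : (ι → ℝ) → ι → ℝ} (hF : Continuous F) :
    ∃ p ∈ stdSimplex ℝ ι, ∀ i, p i = 0 ∨ ∀ j, F p i ≤ F p j := by
  classical
  let r : ℕ → (ι → ℕ) → ι → ℝ := fun n v i => (v i : ℝ) / (n + 1 : ℕ)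
  have hc : ∀ n (v : ι → ℕ), ∃ i, ∀ j, F (r n v) i ≤ F (r n v) j := fun n v =>
    let ⟨i, _, hi⟩ := Finset.exists_min_image Finset.univ (F (r n v)) Finset.univ_nonempty
    ⟨i, fun j => hi j (Finset.mem_univ j)⟩
  choose c hc using hc
  choose v hv hvc using fun n => exists_grid_point (n + 1) (c n)
  have hmem : ∀ n, r n (v n) ∈ stdSimplex ℝ ι := fun n => by
    refine ⟨fun i => by positivity, ?_⟩
    simp only [r]
    rw [← Finset.sum_div, ← Nat.cast_sum, hv n, div_self (by positivity)]
  obtain ⟨p, hp, φ, hφ, hlim⟩ := (isCompact_stdSimplex ℝ ι).tendsto_subseq hmem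
  refine ⟨p, hp, fun i => ?_⟩
  by_contra hcon
  push Not at hcon
  obtain ⟨hpi, j, hj⟩ := hcon
  have hpi : 0 < p i := lt_of_le_of_ne (hp.1 i) hpi.symm
  -- Near `p`, the `i`-th coordinate stays away from zero and `i` is not minimizing. This
  -- contradicts both alternatives at fine grid points: a small coordinate, or a nearby point of
  -- colour `i`.
  have hopen : IsOpen {p' : ι → ℝ | 0 < p' i ∧ F p' j < F p' i} :=
    (isOpen_lt continuous_const (continuous_apply i)).inter
      (isOpen_lt ((continuous_apply j).comp hF) ((continuous_apply i).comp hF))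
  obtain ⟨δ, hδ, hball⟩ := Metric.isOpen_iff.1 hopen p ⟨hpi, hj⟩
  have hδ2 : 0 < min (δ / 2) (p i / 2) := lt_min (by positivity) (by positivity)
  have hsmall : Filter.Tendsto (fun n => (Fintype.card ι : ℝ) / (φ n + 1 : ℕ)) Filter.atTop
      (nhds 0) :=
    ((tendsto_const_div_atTop_nhds_zero_nat (Fintype.card ι : ℝ)).comp
      (Filter.tendsto_add_atTop_nat 1)).comp hφ.tendsto_atTop
  obtain ⟨n, hn1, hn2⟩ := ((Metric.tendsto_nhds.1 hlim _ hδ2).and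
    (hsmall.eventually (gt_mem_nhds hδ2))).exists
  have hn1 : dist (r (φ n) (v (φ n))) p < min (δ / 2) (p i / 2) := hn1
  have hN : (0 : ℝ) < (φ n + 1 : ℕ) := by positivity
  rcases hvc (φ n) i with hs | ⟨v', -, hci, hclose⟩
  · have h1 : r (φ n) (v (φ n)) i < p i / 2 := by
      refine lt_of_le_of_lt ?_ (hn2.trans_le (min_le_right _ _))
      exact div_le_div_of_nonneg_right (by exact_mod_cast hs.le) hN.le
    have h2 := (dist_le_pi_dist (r (φ n) (v (φ n))) p i).trans_lt (hn1.trans_le (min_le_right _ _))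
    rw [Real.dist_eq, abs_lt] at h2
    linarith
  · have hd : dist (r (φ n) v') (r (φ n) (v (φ n))) < δ / 2 := by
      refine lt_of_le_of_lt ((dist_pi_le_iff (by positivity)).2 fun l => ?_)
        (hn2.trans_le (min_le_left _ _))
      simp only [r]
      rw [Real.dist_eq, ← sub_div, abs_div, abs_of_pos hN]
      refine div_le_div_of_nonneg_right ?_ hN.le
      obtain ⟨h1, h2⟩ := hclose l
      have h1 : (v (φ n) l : ℝ) < v' l + Fintype.card ι := by exact_mod_cast h1
      have h2 : (v' l : ℝ) < v (φ n) l + Fintype.card ι := by exact_mod_cast h2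
      rw [abs_le]
      constructor <;> linarith
    have hb : r (φ n) v' ∈ Metric.ball p δ := by
      have := dist_triangle (r (φ n) v') (r (φ n) (v (φ n))) p
      have := hn1.trans_le (min_le_left _ _)
      rw [Metric.mem_ball]
      linarith
    exact (hball hb).2.not_ge (hci ▸ hc (φ n) v' j)

end Simplex

/-! ### Positive matrices and complementarity -/

theorem mem_dualCone_orthant_iff {m : ℕ} {y : Fin m → ℝ} :
    y ∈ dualCone (orthant m) ↔ ∀ i, 0 ≤ y i := by
  constructor
  · intro h i
    simpa using h (Pi.single i 1) fun j => by
      by_cases hj : j = i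
      · subst hj; simp
      · simp [hj]
  · intro h x hx
    exact Finset.sum_nonneg fun i _ => mul_nonneg (hx i) (h i)

/-- Positive matrices are Q-matrices. -/
theorem IsPositive.isQMatrix {m : ℕ} {M : Matrix (Fin m) (Fin m) ℝ} (hM : IsPositive M) :
    IsQMatrix M := by
  classical
  intro q
  let J := {i : Fin m // q i < 0}
  rcases isEmpty_or_nonempty J with hJ | hJ
  · refine ⟨0, fun i => le_rfl, ?_, by simp⟩
    rw [mem_dualCone_orthant_iff]
    intro i
    simpa using not_lt.1 fun h => hJ.false ⟨i, h⟩
  let F : (J → ℝ) → J → ℝ := fun p i => (∑ j : J, M i j * p j) / (-q i)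
  obtain ⟨p, hp, hmin⟩ := exists_mem_stdSimplex_support_minimal (F := F) (by fun_prop)
  obtain ⟨i₀, hi₀⟩ : ∃ i, p i ≠ 0 := by
    by_contra h
    push Not at h
    have := hp.2
    simp [h] at this
  have hmin₀ := (hmin i₀).resolve_left hi₀
  have hrow : ∀ i : Fin m, 0 < ∑ j : J, M i j * p j := fun i =>
    Finset.sum_pos' (fun j _ => mul_nonneg (hM i j).le (hp.1 j))
      ⟨i₀, Finset.mem_univ _, mul_pos (hM i i₀) (lt_of_le_of_ne (hp.1 i₀) hi₀.symm)⟩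
  have hlam : 0 < F p i₀ := div_pos (hrow i₀) (neg_pos.2 i₀.2)
  -- After division by the minimal ratio, `M x + q` is nonnegative on `J` and vanishes on the
  -- support of `p`. Outside `J`, positivity of `M` suffices.
  let x : Fin m → ℝ := fun i => if h : q i < 0 then p ⟨i, h⟩ / F p i₀ else 0
  have hxJ : ∀ j : J, x j = p j / F p i₀ := fun j => dif_pos j.2
  have hx0 : ∀ i, 0 ≤ x i := fun i => by
    by_cases h : q i < 0
    · simp only [x, h, dif_pos]
      exact div_nonneg (hp.1 _) hlam.le
    · simp [x, h]
  have hMx : ∀ i, (M *ᵥ x) i = (∑ j : J, M i j * p j) / F p i₀ := fun i => by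
    have h1 : ∑ j : J, M i j * x j = ∑ j, M i j * x j :=
      (Finset.sum_subtype (Finset.univ.filter fun i => q i < 0) (by simp)
        fun j => M i j * x j).symm.trans <| Finset.sum_subset (Finset.subset_univ _)
          fun j _ hj => by
            have hj : ¬ q j < 0 := by simpa using hj
            simp [x, hj]
    rw [Matrix.mulVec, dotProduct, ← h1, Finset.sum_div]
    exact Finset.sum_congr rfl fun j _ => by rw [hxJ, mul_div_assoc]
  refine ⟨x, hx0, ?_, ?_⟩
  · rw [mem_dualCone_orthant_iff]
    intro i
    rw [Pi.add_apply, hMx]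
    by_cases h : q i < 0
    · have h1 : F p i₀ ≤ (∑ j : J, M i j * p j) / (-q i) := hmin₀ ⟨i, h⟩
      rw [le_div_iff₀ (neg_pos.2 h)] at h1
      have h2 : -q i ≤ (∑ j : J, M i j * p j) / F p i₀ := by
        rw [le_div_iff₀ hlam]
        linarith
      linarith
    · exact add_nonneg (div_nonneg (hrow i).le hlam.le) (not_lt.1 h)
  · refine Finset.sum_eq_zero fun i _ => ?_
    by_cases h : q i < 0
    · rw [Pi.add_apply, hMx, hxJ ⟨i, h⟩]
      rcases hmin ⟨i, h⟩ with h0 | h0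
      · simp [h0]
      · have h1 : (∑ j : J, M i j * p j) / (-q i) = F p i₀ := le_antisymm (h0 i₀) (hmin₀ ⟨i, h⟩)
        rw [div_eq_iff (neg_pos.2 h).ne'] at h1
        rw [h1, mul_div_cancel_left₀ _ hlam.ne', neg_add_cancel, mul_zero]
    · simp [x, h]

/-! ### Matrices in the congruence orbit -/

theorem mul_mul_apply_eq_dotProduct {m : ℕ} (A L : Matrix (Fin m) (Fin m) ℝ) (i j : Fin m) :
    (Lᵀ * A * L) i j = (A *ᵥ (fun k => L k j)) ⬝ᵥ fun k => L k i := by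
  rw [Matrix.mul_assoc, Matrix.mul_apply, dotProduct]
  refine Finset.sum_congr rfl fun k _ => ?_
  rw [Matrix.transpose_apply, Matrix.mul_apply, Matrix.mulVec, dotProduct, mul_comm]

theorem mem_orbit_of_mulVec_injective {m : ℕ} (A : Matrix (Fin m) (Fin m) ℝ)
    {L : Matrix (Fin m) (Fin m) ℝ} (hL : ∀ v, L *ᵥ v = 0 → v = 0) : Lᵀ * A * L ∈ orbit A := by
  have hinj : Function.Injective L.mulVec := by
    intro v w h
    have h0 : L *ᵥ (v - w) = 0 := by
      rw [Matrix.mulVec_sub]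
      exact sub_eq_zero.2 h
    exact sub_eq_zero.1 (hL _ h0)
  obtain ⟨u, rfl⟩ := Matrix.mulVec_injective_iff_isUnit.1 hinj
  exact ⟨u, rfl⟩

/-- A matrix with a nonpositive row is not an F-matrix. -/
theorem not_isFMatrix_of_row_nonpos {m : ℕ} {B : Matrix (Fin m) (Fin m) ℝ} {k : Fin m}
    (hB : ∀ j, B k j ≤ 0) : ¬ IsFMatrix B := by
  intro h
  obtain ⟨_, ⟨x, hx, rfl⟩, hy⟩ := h fun _ => -1
  have h1 : 0 ≤ (B *ᵥ x) k + -1 := mem_dualCone_orthant_iff.1 hy k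
  have h2 : ∑ j, B k j * x j ≤ 0 :=
    Finset.sum_nonpos fun j _ => mul_nonpos_of_nonpos_of_nonneg (hB j) (hx j)
  rw [Matrix.mulVec, dotProduct] at h1
  linarith

/-- Since `y k ≠ 0`, replacing the `k`-th vector of the standard basis by `y` leaves a basis.
Flipping signs of the other vectors makes row `k` of the Gram matrix nonpositive. -/
theorem exists_mem_orbit_not_isFMatrix {m : ℕ} (A : Matrix (Fin m) (Fin m) ℝ) {y : Fin m → ℝ}
    (hy0 : y ≠ 0) (hy : (A *ᵥ y) ⬝ᵥ y ≤ 0) : ∃ B ∈ orbit A, ¬ IsFMatrix B := by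
  classical
  obtain ⟨k, hk⟩ := Function.ne_iff.1 hy0
  rw [Pi.zero_apply] at hk
  have hs : ∀ j, ∃ s : ℝ, s ≠ 0 ∧ s * (y ᵥ* A) j ≤ 0 := fun j => by
    rcases le_total ((y ᵥ* A) j) 0 with h | h
    · exact ⟨1, one_ne_zero, by simpa using h⟩
    · exact ⟨-1, by norm_num, by simpa using h⟩
  choose s hs0 hs using hs
  let L : Matrix (Fin m) (Fin m) ℝ := (Matrix.diagonal s).updateCol k y
  refine ⟨Lᵀ * A * L, mem_orbit_of_mulVec_injective A fun v hv => ?_,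
    not_isFMatrix_of_row_nonpos (k := k) fun j => ?_⟩
  · have hrow : ∀ i, (L *ᵥ v) i = (if i = k then 0 else s i * v i) + y i * v k := by
      intro i
      rw [Matrix.mulVec, dotProduct, ← Finset.sum_erase_add _ _ (Finset.mem_univ k)]
      congr 1
      · rw [Finset.sum_congr rfl fun j hj => by
          rw [show L i j = Matrix.diagonal s i j from
            Matrix.updateCol_ne (Finset.ne_of_mem_erase hj)]]
        simp [Matrix.diagonal_apply]
      · simp [L]
    have hvk : v k = 0 := by
      have := hrow k
      rw [hv] at this
      simpa [hk] using this
    funext i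
    by_cases hik : i = k
    · rw [hik, hvk, Pi.zero_apply]
    · have := hrow i
      rw [hv] at this
      simpa [hik, hvk, hs0 i] using this
  · rw [mul_mul_apply_eq_dotProduct]
    have hLk : (fun i => L i k) = y := by funext i; simp [L]
    rw [hLk]
    by_cases hj : j = k
    · rw [hj, hLk]; exact hy
    · have hLj : (fun i => L i j) = Pi.single j (s j) := by
        funext i
        by_cases hij : i = j
        · subst hij; simp [L, hj]
        · simp [L, hj, hij]
      rw [hLj, dotProduct_comm, Matrix.dotProduct_mulVec, dotProduct_single, mul_comm]
      exact hs j

/-- The columns `x + ε eⱼ` all tend to `x`, so positivity holds for small `ε` by continuity. They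
form a basis as soon as `ε ≠ 0` and `ε + ∑ i, x i ≠ 0`. -/
theorem exists_mem_orbit_isPositive {m : ℕ} (A : Matrix (Fin m) (Fin m) ℝ) {x : Fin m → ℝ}
    (hx : 0 < (A *ᵥ x) ⬝ᵥ x) : ∃ C ∈ orbit A, IsPositive C := by
  classical
  let L : ℝ → Matrix (Fin m) (Fin m) ℝ := fun ε => Matrix.vecMulVec x 1 + ε • 1
  have hL0 : ∀ j, (fun i => L 0 i j) = x := fun j => by
    funext i
    simp [L]
  have hcont : ∀ i j, Continuous fun ε => ((L ε)ᵀ * A * L ε) i j := fun i j => by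
    have hL : Continuous L := by fun_prop
    exact (((hL.matrix_transpose.matrix_mul continuous_const).matrix_mul hL).matrix_elem i j)
  have hpos : ∀ᶠ ε in nhds (0 : ℝ), ∀ i j, 0 < ((L ε)ᵀ * A * L ε) i j := by
    rw [Filter.eventually_all]
    intro i
    rw [Filter.eventually_all]
    intro j
    refine (hcont i j).continuousAt.eventually (lt_mem_nhds ?_)
    change 0 < ((L 0)ᵀ * A * L 0) i j
    rw [mul_mul_apply_eq_dotProduct, hL0, hL0]
    exact hx
  have hne : ∀ᶠ ε in nhdsWithin (0 : ℝ) {0}ᶜ, ε + ∑ i, x i ≠ 0 := by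
    by_cases h : ∑ i, x i = 0
    · filter_upwards [self_mem_nhdsWithin] with ε hε
      simpa [h] using hε
    · refine nhdsWithin_le_nhds ?_
      have : ContinuousAt (fun ε : ℝ => ε + ∑ i, x i) 0 := by fun_prop
      exact this.eventually_ne (by simpa using h)
  obtain ⟨ε, ⟨hε, hεs⟩, hε0⟩ :=
    ((hpos.filter_mono nhdsWithin_le_nhds |>.and hne).and self_mem_nhdsWithin).exists
  refine ⟨(L ε)ᵀ * A * L ε, mem_orbit_of_mulVec_injective A fun v hv => ?_, hε⟩
  have hε0 : ε ≠ 0 := hε0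
  have hrow : ∀ i, x i * ∑ j, v j + ε * v i = 0 := fun i => by
    have := congrFun hv i
    simp only [L, Matrix.add_mulVec, Matrix.smul_mulVec, Matrix.vecMulVec_mulVec, one_dotProduct,
      Matrix.one_mulVec] at this
    simpa using this
  -- Summing the rows isolates `∑ j, v j`, which must vanish; each row then reduces to `ε * v i =
  -- 0`.
  have hsum : (ε + ∑ i, x i) * ∑ j, v j = 0 := by
    have := Finset.sum_eq_zero fun i (_ : i ∈ Finset.univ) => hrow i
    rw [Finset.sum_add_distrib, ← Finset.sum_mul, ← Finset.mul_sum] at this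
    linarith
  have hsv := (mul_eq_zero.1 hsum).resolve_left hεs
  funext i
  have := hrow i
  rw [hsv] at this
  simpa [hε0] using this

end CongruenceOrbit

theorem theorem6p13 {m : ℕ} (A : Matrix (Fin m) (Fin m) ℝ) (hA : IsUnit A)
    (hpos : ∃ x : Fin m → ℝ, 0 < (A *ᵥ x) ⬝ᵥ x)
    (hnonpos : ∃ y : Fin m → ℝ, y ≠ 0 ∧ (A *ᵥ y) ⬝ᵥ y ≤ 0) :
    (∃ B ∈ CongruenceOrbit.orbit A, ¬ CongruenceOrbit.IsFMatrix B) ∧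
      (∃ C ∈ CongruenceOrbit.orbit A,
        CongruenceOrbit.IsPositive C ∧ CongruenceOrbit.IsQMatrix C) := by
  obtain ⟨x, hx⟩ := hpos
  obtain ⟨y, hy0, hy⟩ := hnonpos
  obtain ⟨C, hC, hCpos⟩ := CongruenceOrbit.exists_mem_orbit_isPositive A hx
  exact ⟨CongruenceOrbit.exists_mem_orbit_not_isFMatrix A hy0 hy, C, hC, hCpos, hCpos.isQMatrix⟩
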